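/- Write $2^{[0,1]}$ for the collection of nonempty compact subsets of $[0,1]$. A function $f:[0,1]\to 2^{[0,1]}$ is *surjective* if every $y\in[0,1]$ lies in $f(x)$ for some $x\in[0,1]$; it is *upper semicontinuous* if for every $x$ and every open $U\supseteq f(x)$ there is an open $V\ni x$ such that $f(x')\subseteq U$ for all $x'\in V$; its *graph* is $G(f)=\{(x,y)\in[0,1]^2: y\in f(x)\}$. It has the *Weak Intermediate Value Property* if for all distinct $x_1,x_2\in[0,1]$ (in either order) and every $y_1\in f(x_1)$ there is some $y_2\in f(x_2)$ such that for every $y$ in the closed interval with endpoints $y_1,y_2$ there is some $x$ in the closed interval with endpoints $x_1,x_2$ with $y\in f(x)$. **Theorem.** For each $n\geq 1$ let $f_n:[0,1]\to 2^{[0,1]}$ be a surjective, upper semicontinuous function with a connected graph $G(f_n)$ and the Weak Intermediate Value Property. Then the generalized inverse limit $$\varprojlim\{[0,1],f_n\}=\Big\{(x_0,x_1,x_2,\dots)\in\prod_{i\geq 0}[0,1] : x_{n-1}\in f_n(x_n)\text{ for all } n\geq 1\Big\},$$ with the subspace topology from the product, is connected (and nonempty). -/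

import Mathlib

namespace SetValued

open TopologicalSpace

/-- The graph `G(f) = {(x, y) : y ∈ f x}` of `f : X → 2^Y`, where `2^Y` is the collection of
nonempty compact subsets of `Y`. -/
def graph {X Y : Type*} [TopologicalSpace Y] (f : X → NonemptyCompacts Y) : Set (X × Y) :=
  {p | p.2 ∈ f p.1}

/-- Upper semicontinuity of `f : X → 2^Y`: whenever `f x ⊆ U` with `U` open, `f x' ⊆ U` for all
`x'` near `x`. -/
def IsUSC {X Y : Type*} [TopologicalSpace X] [TopologicalSpace Y]
    (f : X → NonemptyCompacts Y) : Prop :=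
  UpperHemicontinuous fun x => (f x : Set Y)

/-- `f : X → 2^Y` is surjective if every point of `Y` belongs to some value of `f`. -/
def IsSurjective {X Y : Type*} [TopologicalSpace Y] (f : X → NonemptyCompacts Y) : Prop :=
  ∀ y : Y, ∃ x : X, y ∈ f x

/-- The Weak Intermediate Value Property. "Between" is not strict, and `x₁ < x₂` is not
required: `Set.uIcc a b` is the closed interval with endpoints `a` and `b` in either order. -/
def WeakIVP {X Y : Type*} [Lattice X] [Lattice Y] [TopologicalSpace Y]
    (f : X → NonemptyCompacts Y) : Prop :=
  ∀ x₁ x₂ : X, x₁ ≠ x₂ → ∀ y₁ ∈ f x₁, ∃ y₂ ∈ f x₂,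
    ∀ y ∈ Set.uIcc y₁ y₂, ∃ x ∈ Set.uIcc x₁ x₂, y ∈ f x

/-- The generalized inverse limit, as a subset of the product space `∏ i, X i`, of bonding
functions `f i : X (i + 1) → 2^(X i)`. -/
def inverseLimit {X : ℕ → Type*} [∀ i, TopologicalSpace (X i)]
    (f : ∀ i, X (i + 1) → NonemptyCompacts (X i)) : Set (∀ i, X i) :=
  {x | ∀ i, x i ∈ f i (x (i + 1))}

end SetValued

open Set Filter Topology TopologicalSpace unitInterval

namespace SetValued

/-! ### Connectedness via locally constant predicates. -/

section Preconnected

variable {α : Type*} [TopologicalSpace α] {s : Set α}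

/-! Sequences obeying the first `n + 1` conditions are the pullback of the graph of `f 0` along the
zeroth coordinate of the space `T` of sequences obeying `n` conditions for the shifted maps. If such
pullbacks are connected (`isPreconnected_graph_comp`), induction handles the finite stages, and
their decreasing compact intersection is the limit.

For the pullback, a locally constant predicate `A` is descended to the graph of `f`, where
connectedness makes it constant. Descent is a continuation argument. Near each fibre `A` comes from
a predicate on the graph (`IsUSC.exists_locConstOver`). Continuation over an interval is unique
(`LocConstOver.eq_of_eq_fibre`): the base points whose fibre contains a disagreement form a
relatively clopen set, closed by upper semicontinuity and open by the Weak Intermediate Value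
Property (`LocConstOver.eventually_exists`). So the local predicates glue, and connectedness of `T`
spreads the agreement with `A`. -/

/-- A locally constant predicate on a preconnected set is constant. -/
lemma iff_of_isPreconnected (hs : IsPreconnected s) {R : α → Prop}
    (hR : ∀ p ∈ s, ∀ᶠ q in 𝓝[s] p, (R q ↔ R p)) {p q : α} (hp : p ∈ s) (hq : q ∈ s) :
    R p ↔ R q :=
  hs.induction₂' (fun a b => (R a ↔ R b))
    (fun a ha => (hR a ha).mono fun _ hb => ⟨hb.symm, hb⟩)
    (fun _ _ _ _ _ _ h h' => h.trans h') hp hq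

/-- A set on which every locally constant predicate is constant is preconnected. -/
lemma isPreconnected_of_forall_iff
    (h : ∀ R : α → Prop, (∀ p ∈ s, ∀ᶠ q in 𝓝[s] p, (R q ↔ R p)) →
      ∀ p ∈ s, ∀ q ∈ s, R p → R q) : IsPreconnected s := by
  rintro U V hU hV hUV ⟨p, hp, hpU⟩ ⟨q, hq, hqV⟩
  by_contra hne
  have hdisj : ∀ r ∈ s, r ∈ U → r ∉ V := fun r hr hrU hrV => hne ⟨r, hr, hrU, hrV⟩
  refine hdisj q hq (h (· ∈ U) (fun r hr => ?_) p hp q hq hpU) hqV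
  rcases hUV hr with hrU | hrV
  · filter_upwards [mem_nhdsWithin_of_mem_nhds (hU.mem_nhds hrU)] with z hz
    exact iff_of_true hz hrU
  · filter_upwards [mem_nhdsWithin_of_mem_nhds (hV.mem_nhds hrV), self_mem_nhdsWithin]
      with z hz hzs
    exact iff_of_false (fun hzU => hdisj z hzs hzU hz) (fun hrU => hdisj r hr hrU hrV)

/-- The intersection of a directed family of compact preconnected sets is preconnected. -/
lemma isPreconnected_iInter_of_directed [T2Space α] {ι : Type*} [Nonempty ι] {V : ι → Set α}
    (hV : Directed (· ⊇ ·) V) (hc : ∀ i, IsCompact (V i)) (hp : ∀ i, IsPreconnected (V i)) :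
    IsPreconnected (⋂ i, V i) := by
  rintro U W hU hW hUW ⟨p, hpV, hpU⟩ ⟨q, hqV, hqW⟩
  by_contra hne
  have hdisj : ∀ r ∈ ⋂ i, V i, r ∈ U → r ∉ W := fun r hr hrU hrV => hne ⟨r, hr, hrU, hrV⟩
  have hcL : IsCompact (⋂ i, V i) :=
    (hc (Classical.arbitrary ι)).of_isClosed_subset (isClosed_iInter fun i => (hc i).isClosed)
      (iInter_subset _ _)
  -- The two pieces of the intersection are compact, so disjoint open sets separate them; by
  -- compactness these already cover, hence split, some `V i`.
  obtain ⟨U', W', hU', hW', hUU', hWW', hd⟩ := SeparatedNhds.of_isCompact_isCompact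
    (hcL.diff hW) (hcL.diff hU)
    (disjoint_left.2 fun r hr hr' => (hUW hr.1).elim hr'.2 hr.2)
  obtain ⟨i, hi⟩ := exists_subset_nhds_of_isCompact hV hc (U := U' ∪ W') fun r hr => by
    refine (hU'.union hW').mem_nhds ?_
    by_cases hrW : r ∈ W
    · exact Or.inr (hWW' ⟨hr, fun hrU => hdisj r hr hrU hrW⟩)
    · exact Or.inl (hUU' ⟨hr, hrW⟩)
  obtain ⟨r, -, hrU, hrW⟩ := hp i U' W' hU' hW' hi
    ⟨p, mem_iInter.1 hpV i, hUU' ⟨hpV, hdisj p hpV hpU⟩⟩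
    ⟨q, mem_iInter.1 hqV i, hWW' ⟨hqV, fun hqU => hdisj q hqV hqU hqW⟩⟩
  exact disjoint_left.1 hd hrU hrW

end Preconnected

/-! ### Upper semicontinuity and extension from a fibre. -/

section UpperSemicontinuous

variable {X Y : Type*} [TopologicalSpace X] [TopologicalSpace Y] {f : X → NonemptyCompacts Y}

lemma IsUSC.comp {Z : Type*} [TopologicalSpace Z] (hf : IsUSC f) {g : Z → X}
    (hg : Continuous g) : IsUSC (f ∘ g) :=
  upperHemicontinuous_iff_forall_isOpen.2 fun z u hu hz =>
    hg.continuousAt.eventually (UpperHemicontinuous.forall_isOpen hf (g z) u hu hz)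

/-- A property that holds in the graph near every point of a fibre holds in all nearby fibres. -/
lemma IsUSC.eventually_forall (hf : IsUSC f) {x : X} {φ : X × Y → Prop}
    (h : ∀ y ∈ f x, ∀ᶠ q in 𝓝[graph f] (x, y), φ q) :
    ∀ᶠ x' in 𝓝 x, ∀ y ∈ f x', φ (x', y) := by
  -- Tube lemma: the fibre is compact.
  have key : ∀ᶠ q in 𝓝 x ×ˢ 𝓝ˢ (f x : Set Y), q ∈ graph f → φ q := by
    rw [(f x).isCompact.prod_nhdsSet_eq_biSup]
    simp only [eventually_iSup]
    intro y hy
    rw [← nhds_prod_eq]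
    exact eventually_nhdsWithin_iff.1 (h y hy)
  obtain ⟨p, hp, u, hu, hpu⟩ := eventually_prod_iff.1 key
  obtain ⟨v, hv, hfv, hvu⟩ := mem_nhdsSet_iff_exists.1 hu
  filter_upwards [hp, UpperHemicontinuous.forall_isOpen hf x v hv hfv] with x' hx' hsub y hy
  exact hpu hx' (hvu (hsub hy)) hy

lemma IsUSC.isClosed_graph [T2Space Y] (hf : IsUSC f) : IsClosed (graph f) := by
  rw [← isOpen_compl_iff, isOpen_iff_mem_nhds]
  rintro ⟨x, y⟩ hxy
  obtain ⟨u, v, hu, hv, hfu, hyv, hd⟩ := SeparatedNhds.of_isCompact_isCompact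
    (f x).isCompact (isCompact_singleton (x := y))
    (disjoint_singleton_right.2 hxy)
  filter_upwards [prod_mem_nhds (UpperHemicontinuous.forall_isOpen hf x u hu hfu)
    (hv.mem_nhds (hyv rfl))] with q hq hqf
  exact disjoint_left.1 hd (hq.1 hqf) hq.2

/-- `R` is locally constant on the part of the graph of `f` that lies over `J`. -/
def LocConstOver (f : X → NonemptyCompacts Y) (J : Set X) (R : X × Y → Prop) : Prop :=
  ∀ p ∈ graph f, p.1 ∈ J → ∀ᶠ q in 𝓝[graph f] p, (R q ↔ R p)

lemma LocConstOver.mono {J J' : Set X} {R : X × Y → Prop} (h : LocConstOver f J R)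
    (hJ : J' ⊆ J) : LocConstOver f J' R :=
  fun p hp hpJ => h p hp (hJ hpJ)

lemma LocConstOver.union {J J' : Set X} {R : X × Y → Prop} (h : LocConstOver f J R)
    (h' : LocConstOver f J' R) : LocConstOver f (J ∪ J') R :=
  fun p hp hpJ => hpJ.elim (h p hp) (h' p hp)

/-- Openness of `J` keeps nearby graph points over `J`, so glued predicates inherit local constancy
from their pieces. -/
lemma LocConstOver.congr {J : Set X} {R R' : X × Y → Prop} (h : LocConstOver f J R)
    (hJ : IsOpen J) (hR : ∀ x ∈ J, ∀ y ∈ f x, (R' (x, y) ↔ R (x, y))) : LocConstOver f J R' := by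
  intro p hp hpJ
  have hev : ∀ᶠ q : X × Y in 𝓝[graph f] p, q.1 ∈ J :=
    mem_nhdsWithin_of_mem_nhds (continuous_fst.continuousAt.eventually (hJ.mem_nhds hpJ))
  filter_upwards [h p hp hpJ, hev, self_mem_nhdsWithin] with q h1 h2 h3
  rw [hR q.1 h2 q.2 h3, hR p.1 hpJ p.2 hp]
  exact h1

/-- A locally constant predicate on one fibre of `f ∘ g` extends to the nearby fibres of `f`. -/
lemma IsUSC.exists_locConstOver [T2Space Y] {T : Type*} [TopologicalSpace T] (hf : IsUSC f)
    {g : T → X} (hg : Continuous g) {A : T × Y → Prop} (hA : LocConstOver (f ∘ g) univ A) (t : T) :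
    ∃ N ∈ 𝓝 (g t), ∃ Q : X × Y → Prop, LocConstOver f N Q ∧
      ∀ᶠ t' in 𝓝 t, ∀ y ∈ f (g t'), (A (t', y) ↔ Q (g t', y)) := by
  have hfib : ∀ y ∈ f (g t), ∀ᶠ z in 𝓝[(f (g t) : Set Y)] y, (A (t, z) ↔ A (t, y)) := by
    intro y hy
    have := eventually_nhdsWithin_iff.1 (hA (t, y) hy (mem_univ _))
    exact eventually_nhdsWithin_iff.2 ((Continuous.prodMk_right t).continuousAt.eventually this)
  have hcpt : ∀ B : Y → Prop, (∀ y ∈ f (g t), ∀ᶠ z in 𝓝[(f (g t) : Set Y)] y, (B z ↔ B y)) →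
      IsCompact {y | y ∈ f (g t) ∧ B y} := by
    intro B hB
    refine (f (g t)).isCompact.of_isClosed_subset (isClosed_of_closure_subset ?_) fun y hy => hy.1
    intro y hy
    have hyf : y ∈ f (g t) :=
      (f (g t)).isCompact.isClosed.closure_subset_iff.2 (fun _ h => h.1) hy
    obtain ⟨z, hz, hz'⟩ := mem_closure_iff_frequently.1 hy |>.and_eventually
      (eventually_nhdsWithin_iff.1 (hB y hyf)) |>.exists
    exact ⟨hyf, (hz' hz.1).1 hz.2⟩
  -- `A` splits the fibre into two compact pieces. Nearby fibres stay in `O ∪ O'`, so membership of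
  -- `y` in `O` serves as `Q`.
  obtain ⟨O, O', hO, hO', hAO, hAO', hd⟩ := SeparatedNhds.of_isCompact_isCompact
    (hcpt (fun y => A (t, y)) hfib)
    (hcpt (fun y => ¬ A (t, y)) fun y hy => (hfib y hy).mono fun _ h => not_congr h)
    (disjoint_left.2 fun _ h h' => h'.2 h.2)
  have hsub : (f (g t) : Set Y) ⊆ O ∪ O' := fun y hy => by
    by_cases h : A (t, y)
    · exact Or.inl (hAO ⟨hy, h⟩)
    · exact Or.inr (hAO' ⟨hy, h⟩)
  have hloc : ∀ y ∈ O ∪ O', ∀ᶠ z in 𝓝 y, (z ∈ O ↔ y ∈ O) := by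
    rintro y (hy | hy)
    · filter_upwards [hO.mem_nhds hy] with z hz using iff_of_true hz hy
    · filter_upwards [hO'.mem_nhds hy] with z hz using
        iff_of_false (disjoint_right.1 hd hz) (disjoint_right.1 hd hy)
  refine ⟨_, UpperHemicontinuous.forall_isOpen hf (g t) _ (hO.union hO') hsub,
    fun p => p.2 ∈ O, ?_, ?_⟩
  · intro p hp hpN
    exact mem_nhdsWithin_of_mem_nhds (continuous_snd.continuousAt.eventually (hloc _ (hpN hp)))
  · refine (hf.comp hg).eventually_forall (φ := fun q => A q ↔ q.2 ∈ O) fun y hy => ?_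
    have h2 : ∀ᶠ q : T × Y in 𝓝[graph (f ∘ g)] (t, y), (q.2 ∈ O ↔ y ∈ O) :=
      mem_nhdsWithin_of_mem_nhds
        ((continuous_snd.continuousAt (x := (t, y))).eventually (hloc y (hsub hy)))
    filter_upwards [hA (t, y) hy (mem_univ _), h2] with q hq hq2
    rw [hq, hq2]
    refine ⟨fun h => hAO ⟨hy, h⟩, fun h => ?_⟩
    by_contra h'
    exact disjoint_left.1 hd h (hAO' ⟨hy, h'⟩)

end UpperSemicontinuous

/-! ### Propagation between fibres and descent. -/

section WeakIVP

variable {f : I → NonemptyCompacts I}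

/-- If a predicate is locally constant on the graph near a fibre and holds somewhere on that
fibre, then it holds somewhere on each nearby fibre. -/
lemma LocConstOver.eventually_exists (hf : IsUSC f) (hw : WeakIVP f) {J : Set I}
    {R : I × I → Prop} (hR : LocConstOver f J R) {x y : I} (hx : x ∈ J) (hy : y ∈ f x)
    (hxy : R (x, y)) : ∀ᶠ x' in 𝓝 x, ∃ y' ∈ f x', R (x', y') := by
  by_contra hcon
  obtain ⟨𝒰, h𝒰⟩ := exists_ultrafilter_iff.2 (frequently_iff_neBot.1 (not_eventually.1 hcon))
  have hbad : ∀ᶠ x' in (𝒰 : Filter I), ¬ ∃ y' ∈ f x', R (x', y') :=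
    h𝒰.trans inf_le_right (mem_principal_self _)
  have hlim : Tendsto id (𝒰 : Filter I) (𝓝 x) := h𝒰.trans inf_le_left
  have hchoice : ∀ x' : I, ∃ y' ∈ f x', x' ≠ x →
      ∀ z ∈ uIcc y y', ∃ w ∈ uIcc x x', z ∈ f w := by
    intro x'
    by_cases h : x' = x
    · obtain ⟨z, hz⟩ := (f x').nonempty
      exact ⟨z, hz, fun h' => absurd h h'⟩
    · obtain ⟨y', hy', h'⟩ := hw x x' (Ne.symm h) y hy
      exact ⟨y', hy', fun _ => h'⟩
  choose g hg hgi using hchoice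
  have hne : ∀ᶠ x' in (𝒰 : Filter I), x' ≠ x := by
    filter_upwards [hbad] with x' hx' h
    subst h
    exact hx' ⟨y, hy, hxy⟩
  obtain ⟨b, -, hb⟩ := isCompact_univ.ultrafilter_le_nhds (𝒰.map g) (by simp)
  have hb : Tendsto g 𝒰 (𝓝 b) := hb
  have hpair : Tendsto (fun x' => (x', g x')) (𝒰 : Filter I) (𝓝 (x, b)) := hlim.prodMk_nhds hb
  have hbf : b ∈ f x :=
    hf.isClosed_graph.mem_of_tendsto hpair (Eventually.of_forall fun x' => hg x')
  -- A point `z ≠ b` of the segment eventually lies between `y` and `g x'`, hence in some `f w` with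
  -- `w` squeezed to `x`; the closed graph puts `z` in `f x`. Thus `R` travels along the segment
  -- from `y` to `b`.
  have hseg : ∀ z ∈ uIcc y b, z ∈ f x := by
    intro z hz
    by_cases hzb : z = b
    · exact hzb ▸ hbf
    by_cases hzy : z = y
    · exact hzy ▸ hy
    have hev : ∀ᶠ x' in (𝒰 : Filter I), z ∈ uIcc y (g x') := by
      rcases mem_uIcc.1 hz with ⟨h1, h2⟩ | ⟨h1, h2⟩
      · filter_upwards [hb.eventually (lt_mem_nhds (lt_of_le_of_ne h2 hzb))] with x' hx'
        exact mem_uIcc.2 (Or.inl ⟨h1, hx'.le⟩)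
      · filter_upwards [hb.eventually (gt_mem_nhds (lt_of_le_of_ne h1 (Ne.symm hzb)))] with x' hx'
        exact mem_uIcc.2 (Or.inr ⟨hx'.le, h2⟩)
    have hw' : ∀ x' : I, ∃ w ∈ uIcc x x', (x' ≠ x → z ∈ uIcc y (g x') → z ∈ f w) := by
      intro x'
      by_cases h : x' ≠ x ∧ z ∈ uIcc y (g x')
      · obtain ⟨w, hw, hzw⟩ := hgi x' h.1 z h.2
        exact ⟨w, hw, fun _ _ => hzw⟩
      · exact ⟨x, left_mem_uIcc, fun h1 h2 => absurd ⟨h1, h2⟩ h⟩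
    choose w hwi hwf using hw'
    have hwlim : Tendsto w (𝒰 : Filter I) (𝓝 x) := by
      have h1 : Tendsto (fun x' => x ⊓ x') (𝒰 : Filter I) (𝓝 (x ⊓ x)) :=
        tendsto_const_nhds.inf_nhds hlim
      have h2 : Tendsto (fun x' => x ⊔ x') (𝒰 : Filter I) (𝓝 (x ⊔ x)) :=
        tendsto_const_nhds.sup_nhds hlim
      rw [inf_idem] at h1
      rw [sup_idem] at h2
      exact tendsto_of_tendsto_of_tendsto_of_le_of_le h1 h2 (fun x' => (hwi x').1)
        (fun x' => (hwi x').2)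
    have hwz : Tendsto (fun x' => (w x', z)) (𝒰 : Filter I) (𝓝 (x, z)) :=
      hwlim.prodMk_nhds tendsto_const_nhds
    refine hf.isClosed_graph.mem_of_tendsto hwz ?_
    filter_upwards [hne, hev] with x' h1 h2 using hwf x' h1 h2
  have hRb : R (x, b) := by
    refine (iff_of_isPreconnected (R := fun z => R (x, z))
      (ordConnected_uIcc (a := y) (b := b)).isPreconnected
      (fun z hz => ?_) left_mem_uIcc right_mem_uIcc).1 hxy
    have h1 := eventually_nhdsWithin_iff.1 (hR (x, z) (hseg z hz) hx)
    have h2 := (Continuous.prodMk_right x).continuousAt.eventually h1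
    filter_upwards [mem_nhdsWithin_of_mem_nhds h2, self_mem_nhdsWithin] with z' h3 h4
    exact h3 (hseg z' h4)
  have hfin := hpair.eventually (eventually_nhdsWithin_iff.1 (hR (x, b) hbf hx))
  obtain ⟨x', h1, h2⟩ := (hbad.and hfin).exists
  exact h1 ⟨g x', hg x', (h2 (hg x')).2 hRb⟩

/-- Two locally constant predicates over a preconnected set that agree on one fibre agree. -/
lemma LocConstOver.eq_of_eq_fibre (hf : IsUSC f) (hw : WeakIVP f) {J : Set I}
    (hJ : IsPreconnected J) {Q Q' : I × I → Prop} (hQ : LocConstOver f J Q)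
    (hQ' : LocConstOver f J Q') {x₀ : I} (hx₀ : x₀ ∈ J)
    (h₀ : ∀ y ∈ f x₀, (Q (x₀, y) ↔ Q' (x₀, y))) {x y : I} (hx : x ∈ J) (hy : y ∈ f x) :
    Q (x, y) ↔ Q' (x, y) := by
  let R : I × I → Prop := fun p => ¬ (Q p ↔ Q' p)
  have hR : LocConstOver f J R := fun p hp hpJ => by
    filter_upwards [hQ p hp hpJ, hQ' p hp hpJ] with q h1 h2
    simp only [R, h1, h2]
  have hiff : (∃ z ∈ f x₀, R (x₀, z)) ↔ ∃ z ∈ f x, R (x, z) := by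
    refine iff_of_isPreconnected (R := fun a => ∃ z ∈ f a, R (a, z)) hJ (fun a ha => ?_) hx₀ hx
    refine mem_nhdsWithin_of_mem_nhds ?_
    by_cases h : ∃ z ∈ f a, R (a, z)
    · obtain ⟨z, hz, hRz⟩ := h
      filter_upwards [hR.eventually_exists hf hw ha hz hRz] with a' ha'
      exact iff_of_true ha' ⟨z, hz, hRz⟩
    · have := hf.eventually_forall (x := a) (φ := fun q => ¬ R q) fun z hz => by
        filter_upwards [hR (a, z) hz ha] with q hq
        exact fun hRq => h ⟨z, hz, hq.1 hRq⟩
      filter_upwards [this] with a' ha'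
      exact iff_of_false (fun ⟨z, hz, hRz⟩ => ha' z hz hRz) h
  by_contra hne
  obtain ⟨z, hz, hRz⟩ := hiff.2 ⟨y, hy, hne⟩
  exact hRz (h₀ z hz)

/-- A locally constant predicate on the pullback of the graph of `f` along a surjection from a
connected space descends to the graph of `f`. -/
lemma exists_locConstOver_univ (hf : IsUSC f) (hw : WeakIVP f) {T : Type*} [TopologicalSpace T]
    [ConnectedSpace T] {g : T → I} (hg : Continuous g) (hgs : Function.Surjective g)
    {A : T × I → Prop} (hA : LocConstOver (f ∘ g) univ A) :
    ∃ Q : I × I → Prop, LocConstOver f univ Q ∧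
      ∀ t, ∀ y ∈ f (g t), (A (t, y) ↔ Q (g t, y)) := by
  obtain ⟨t₀⟩ := (inferInstance : Nonempty T)
  -- Continuations normalised by `A` on the fibre at `t₀`; `Q₀` is their union. Domains are
  -- intervals, so overlaps are connected and uniqueness applies.
  let F : Set I → (I × I → Prop) → Prop := fun J Q => IsOpen J ∧ IsPreconnected J ∧ g t₀ ∈ J ∧
    LocConstOver f J Q ∧ ∀ y ∈ f (g t₀), (A (t₀, y) ↔ Q (g t₀, y))
  let Q₀ : I × I → Prop := fun p => ∃ J Q, F J Q ∧ p.1 ∈ J ∧ Q p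
  let J₀ : Set I := {x | ∃ J Q, F J Q ∧ x ∈ J}
  have hQ₀ : ∀ {J Q}, F J Q → ∀ x ∈ J, ∀ y ∈ f x, (Q₀ (x, y) ↔ Q (x, y)) := by
    intro J Q hF x hx y hy
    refine ⟨?_, fun h => ⟨J, Q, hF, hx, h⟩⟩
    rintro ⟨J', Q', hF', hx', h⟩
    refine (LocConstOver.eq_of_eq_fibre (J := J ∩ J') hf hw
      (hF.2.1.ordConnected.inter hF'.2.1.ordConnected).isPreconnected
      (hF.2.2.2.1.mono inter_subset_left) (hF'.2.2.2.1.mono inter_subset_right)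
      ⟨hF.2.2.1, hF'.2.2.1⟩ (fun z hz => ?_) ⟨hx, hx'⟩ hy).2 h
    rw [← hF.2.2.2.2 z hz, ← hF'.2.2.2.2 z hz]
  have hJ₀ : IsOpen J₀ := isOpen_iff_mem_nhds.2 fun x ⟨J, Q, hF, hx⟩ =>
    mem_of_superset (hF.1.mem_nhds hx) fun x' hx' => ⟨J, Q, hF, hx'⟩
  have hJ₀c : IsPreconnected J₀ := by
    have : J₀ = ⋃₀ {J | ∃ Q, F J Q} := by
      ext x
      simp only [J₀, mem_ofPred_eq, mem_sUnion]
      exact ⟨fun ⟨J, Q, h, hx⟩ => ⟨J, ⟨Q, h⟩, hx⟩, fun ⟨J, ⟨Q, h⟩, hx⟩ => ⟨J, Q, h, hx⟩⟩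
    rw [this]
    exact isPreconnected_sUnion (g t₀) _ (fun J ⟨Q, h⟩ => h.2.2.1) fun J ⟨Q, h⟩ => h.2.1
  have hlc : LocConstOver f J₀ Q₀ := by
    rintro p hp ⟨J, Q, hF, hx⟩
    exact hF.2.2.2.1.congr hF.1 (hQ₀ hF) p hp hx
  have hloc : ∀ t, ∃ N : Set I, IsOpen N ∧ IsPreconnected N ∧ g t ∈ N ∧ ∃ Q : I × I → Prop,
      LocConstOver f N Q ∧
      ∀ᶠ t' in 𝓝 t, g t' ∈ N ∧ ∀ y ∈ f (g t'), (A (t', y) ↔ Q (g t', y)) := by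
    intro t
    obtain ⟨N, hN, Q, hQ, hev⟩ := hf.exists_locConstOver hg hA t
    obtain ⟨ε, hε, hN⟩ := Metric.mem_nhds_iff.1 hN
    have hord : OrdConnected (Metric.ball (g t) ε) := by
      have : OrdConnected (Metric.ball (g t : ℝ) ε) := Real.ball_eq_Ioo _ _ ▸ ordConnected_Ioo
      exact this.preimage_mono (Subtype.mono_coe _)
    exact ⟨_, Metric.isOpen_ball, hord.isPreconnected, Metric.mem_ball_self hε, Q, hQ.mono hN,
      (hg.continuousAt.eventually (Metric.ball_mem_nhds _ hε)).and hev⟩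
  let S : Set T := {t | g t ∈ J₀ ∧ ∀ y ∈ f (g t), (A (t, y) ↔ Q₀ (g t, y))}
  -- Gluing `Q` to `Q₀` gives another member of `F`, so `N` already lies in `J₀`. This yields both
  -- openness and closedness of `S`.
  have hkey : ∀ {N : Set I} {Q : I × I → Prop}, IsOpen N → IsPreconnected N →
      LocConstOver f N Q → ∀ t ∈ S, g t ∈ N → (∀ y ∈ f (g t), (A (t, y) ↔ Q (g t, y))) →
      ∀ t', g t' ∈ N → (∀ y ∈ f (g t'), (A (t', y) ↔ Q (g t', y))) → t' ∈ S := by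
    intro N Q hNo hNc hQ t ht htN htQ t' ht'N ht'Q
    have hagree : ∀ x ∈ J₀ ∩ N, ∀ y ∈ f x, (Q₀ (x, y) ↔ Q (x, y)) := fun x hx y hy =>
      LocConstOver.eq_of_eq_fibre hf hw
        (hJ₀c.ordConnected.inter hNc.ordConnected).isPreconnected
        (hlc.mono inter_subset_left) (hQ.mono inter_subset_right) ⟨ht.1, htN⟩
        (fun z hz => by rw [← ht.2 z hz, htQ z hz]) hx hy
    let Q₁ : I × I → Prop := fun p => (p.1 ∈ J₀ ∧ Q₀ p) ∨ (p.1 ∈ N ∧ Q p)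
    have hQ₁J : ∀ x ∈ J₀, ∀ y ∈ f x, (Q₁ (x, y) ↔ Q₀ (x, y)) := fun x hx y hy =>
      ⟨fun h => h.elim (fun h => h.2) fun h => (hagree x ⟨hx, h.1⟩ y hy).2 h.2,
        fun h => Or.inl ⟨hx, h⟩⟩
    have hQ₁N : ∀ x ∈ N, ∀ y ∈ f x, (Q₁ (x, y) ↔ Q (x, y)) := fun x hx y hy =>
      ⟨fun h => h.elim (fun h => (hagree x ⟨h.1, hx⟩ y hy).1 h.2) fun h => h.2,
        fun h => Or.inr ⟨hx, h⟩⟩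
    have hlc₁ : LocConstOver f (J₀ ∪ N) Q₁ :=
      (hlc.congr hJ₀ hQ₁J).union (hQ.congr hNo hQ₁N)
    obtain ⟨J, QJ, hF, hxJ⟩ := ht.1
    have hF₁ : F (J₀ ∪ N) Q₁ :=
      ⟨hJ₀.union hNo, hJ₀c.union (g t) ht.1 htN hNc, Or.inl ⟨J, QJ, hF, hF.2.2.1⟩, hlc₁,
        fun y hy => by
          rw [hQ₁J _ ⟨J, QJ, hF, hF.2.2.1⟩ y hy, hQ₀ hF _ hF.2.2.1 y hy, hF.2.2.2.2 y hy]⟩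
    refine ⟨⟨_, _, hF₁, Or.inr ht'N⟩, fun y hy => ?_⟩
    rw [hQ₀ hF₁ _ (Or.inr ht'N) y hy, hQ₁N _ ht'N y hy, ht'Q y hy]
  have hS : S = univ := by
    refine IsClopen.eq_univ ⟨isClosed_of_closure_subset fun t ht => ?_,
      isOpen_iff_mem_nhds.2 fun t ht => ?_⟩ ⟨t₀, ?_⟩
    · obtain ⟨N, hNo, hNc, htN, Q, hQ, hev⟩ := hloc t
      obtain ⟨t', ht', h⟩ := (mem_closure_iff_frequently.1 ht |>.and_eventually hev).exists
      exact hkey hNo hNc hQ t' ht' h.1 h.2 t htN hev.self_of_nhds.2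
    · obtain ⟨N, hNo, hNc, htN, Q, hQ, hev⟩ := hloc t
      filter_upwards [hev] with t' h
      exact hkey hNo hNc hQ t ht htN hev.self_of_nhds.2 t' h.1 h.2
    · obtain ⟨N, hNo, hNc, htN, Q, hQ, hev⟩ := hloc t₀
      have hF : F N Q := ⟨hNo, hNc, htN, hQ, hev.self_of_nhds.2⟩
      exact ⟨⟨N, Q, hF, htN⟩, fun y hy => by
        rw [hQ₀ hF _ htN y hy, hev.self_of_nhds.2 y hy]⟩
  have hSt : ∀ t, t ∈ S := fun t => hS ▸ mem_univ t
  refine ⟨Q₀, hlc.mono fun x _ => ?_, fun t => (hSt t).2⟩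
  obtain ⟨t, rfl⟩ := hgs x
  exact (hSt t).1

/-- The pullback of the graph of `f` along a continuous surjection from a connected space is
preconnected. -/
lemma isPreconnected_graph_comp (hf : IsUSC f) (hw : WeakIVP f) (hG : IsPreconnected (graph f))
    {T : Type*} [TopologicalSpace T] [ConnectedSpace T] {g : T → I} (hg : Continuous g)
    (hgs : Function.Surjective g) : IsPreconnected (graph (f ∘ g)) := by
  refine isPreconnected_of_forall_iff fun A hA => ?_
  obtain ⟨Q, hQ, hAQ⟩ := exists_locConstOver_univ hf hw hg hgs fun p hp _ => hA p hp
  rintro ⟨t, y⟩ hp ⟨t', y'⟩ hq h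
  rw [hAQ t' y' hq]
  exact (iff_of_isPreconnected hG (fun p hp => hQ p hp (mem_univ _))
    (p := (g t, y)) (q := (g t', y')) hp hq).1 ((hAQ t y hp).1 h)

end WeakIVP

/-! ### Finite stages and their intersection. -/

section InverseLimit

/-- The sequences that satisfy the first `n` conditions of the inverse limit. -/
def partialLimit (f : ℕ → I → NonemptyCompacts I) (n : ℕ) : Set (ℕ → I) :=
  {x | ∀ i < n, x i ∈ f i (x (i + 1))}

variable {f : ℕ → I → NonemptyCompacts I}

lemma iInter_partialLimit : ⋂ n, partialLimit f n = inverseLimit (X := fun _ => I) f := by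
  ext x
  exact mem_iInter.trans ⟨fun h i => h (i + 1) i i.lt_succ_self, fun h _ i _ => h i⟩

lemma isClosed_partialLimit (hf : ∀ n, IsUSC (f n)) (n : ℕ) : IsClosed (partialLimit f n) := by
  have : partialLimit f n = ⋂ i, ⋂ (_ : i < n), (fun x : ℕ → I => (x (i + 1), x i)) ⁻¹'
      graph (f i) := by
    ext x
    simp only [mem_iInter]
    rfl
  rw [this]
  exact isClosed_iInter fun i => isClosed_iInter fun _ =>
    (hf i).isClosed_graph.preimage (by fun_prop)

lemma exists_mem_inverseLimit (hs : ∀ n, IsSurjective (f n)) (a : I) :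
    ∃ x ∈ inverseLimit (X := fun _ => I) f, x 0 = a := by
  choose g hg using hs
  exact ⟨fun n => Nat.rec a g n, fun i => hg i _, rfl⟩

lemma isConnected_partialLimit (n : ℕ) : ∀ {f : ℕ → I → NonemptyCompacts I},
    (∀ n, IsSurjective (f n)) → (∀ n, IsUSC (f n)) → (∀ n, IsConnected (graph (f n))) →
    (∀ n, WeakIVP (f n)) → IsConnected (partialLimit f n) := by
  induction n with
  | zero =>
    intro f _ _ _ _
    have : partialLimit f 0 = univ := eq_univ_of_forall fun x i hi => absurd hi i.not_lt_zero
    rw [this]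
    exact isConnected_univ
  | succ n ih =>
    intro f hs hu hG hw
    obtain ⟨a, ha, -⟩ := exists_mem_inverseLimit hs 0
    refine ⟨⟨a, fun i _ => ha i⟩, ?_⟩
    have hc := ih (f := fun k => f (k + 1)) (fun k => hs _) (fun k => hu _) (fun k => hG _)
      fun k => hw _
    let T := partialLimit (fun k => f (k + 1)) n
    have : ConnectedSpace T := isConnected_iff_connectedSpace.1 hc
    let g : T → I := fun t => t.1 0
    have hg : Continuous g := (continuous_apply 0).comp continuous_subtype_val
    have hgs : Function.Surjective g := fun b => by
      obtain ⟨x, hx, hx0⟩ := exists_mem_inverseLimit (fun k => hs (k + 1)) b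
      exact ⟨⟨x, fun i _ => hx i⟩, hx0⟩
    -- Prepends the new zeroth coordinate, identifying the pullback with stage `n + 1`.
    let c : T × I → ℕ → I := fun p k => Nat.casesOn k p.2 fun k => p.1.1 k
    have hcc : Continuous c := continuous_pi fun k => by
      cases k with
      | zero => exact continuous_snd
      | succ k =>
        exact (continuous_apply k).comp (continuous_subtype_val.comp continuous_fst)
    have himg : c '' graph (f 0 ∘ g) = partialLimit f (n + 1) := by
      ext x
      constructor
      · rintro ⟨⟨t, y⟩, hp, rfl⟩ i hi
        cases i with
        | zero => exact hp
        | succ i => exact t.2 i (Nat.lt_of_succ_lt_succ hi)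
      · intro hx
        refine ⟨(⟨fun k => x (k + 1), fun i hi => hx (i + 1) (Nat.succ_lt_succ hi)⟩, x 0),
          hx 0 n.succ_pos, ?_⟩
        funext k
        cases k <;> rfl
    rw [← himg]
    exact (isPreconnected_graph_comp (hu 0) (hw 0) (hG 0).isPreconnected hg hgs).image c
      hcc.continuousOn

end InverseLimit

end SetValued

theorem theorem3p6
    (f : ℕ → unitInterval → TopologicalSpace.NonemptyCompacts unitInterval)
    (hsurj : ∀ n, SetValued.IsSurjective (f n))
    (husc : ∀ n, SetValued.IsUSC (f n))
    (hgraph : ∀ n, IsConnected (SetValued.graph (f n)))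
    (hwivp : ∀ n, SetValued.WeakIVP (f n)) :
    IsConnected (SetValued.inverseLimit (X := fun _ => unitInterval) f) := by
  obtain ⟨a, ha, -⟩ := SetValued.exists_mem_inverseLimit hsurj 0
  refine ⟨⟨a, ha⟩, ?_⟩
  rw [← SetValued.iInter_partialLimit]
  refine SetValued.isPreconnected_iInter_of_directed ?_
    (fun n => (SetValued.isClosed_partialLimit husc n).isCompact)
    fun n => (SetValued.isConnected_partialLimit n hsurj husc hgraph hwivp).isPreconnected
  exact directed_of_isDirected_le fun m n hmn x hx i hi => hx i (hi.trans_le hmn)
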